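/- Let $\mathbb{T}=(\mathbb{R}\cup\{-\infty\},\max,+)$, let $d\ge 1$ and $m\ge 0$ be integers, let $M\in\mathbb{T}^{d\times m}$ be a matrix with all entries in $\mathbb{Z}_{\ge 0}\cup\{-\infty\}$, and let $P=\mathrm{tconv}(M)\subseteq\mathbb{T}^d$ be the tropical convex hull of the columns $M_{\cdot 1},\dots,M_{\cdot m}$ of $M$, i.e. the set of all $x$ with $x_k=\max_j(\lambda_j+M_{kj})$ for all $k$, where $\lambda_j\in\mathbb{T}$ and $\max_j\lambda_j=0$. Let $\mathcal F_P$ be the covector decomposition of $P$, i.e. the decomposition into the relatively open cells consisting of the points of $P$ with the same covector (type) with respect to the vertices of $P$ (the minimal generating set). For $1\le i\le d$ let the $i$-trunk $\mathrm{Tr}_i(P)$ be the union of all $F\in\mathcal F_P$ that are contained in the closure of some $G\in\mathcal F_P$ with $\dim G\ge i$. Define the tropical lower barycentric $i$-volume $$\mathrm{tbvol}_i^-(P)=\max_{x\in \mathrm{Tr}_i(P)}\ \min_{I\subseteq[d],\,|I|=i}\ \sum_{k\in I}x_k ,$$ the tropical barycentric volume $\mathrm{tbvol}(P)=\max_{x\in\mathrm{Tr}_d(P)}\sum_{k=1}^d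 x_k$, and the maximal tropical $i$-minor $$\mathrm{tminor}_i(M)=\max_{I\subseteq[d],\,J\subseteq[m],\,|I|=|J|=i}\mathrm{tdet}(M_{I,J}),\qquad \mathrm{tdet}(A)=\max_{\sigma\in S_i}\sum_{l=1}^i A_{l,\sigma(l)},$$ where a maximum over the empty set is $-\infty$. Finally let $\mathbb{K}$ be the field of absolutely convergent generalized real Puiseux series $\sum_\alpha c_\alpha t^\alpha$ in a large parameter $t$ (real exponents, only finitely many above any given bound, absolutely convergent for all large $t$), let $\mathrm{val}$ of a nonzero series be its largest exponent, $\mathrm{val}(0)=-\infty$, and for $\mathbf M\in\mathbb K^{d\times m}$ let $\mathrm{vol}\,\mathbf M\in\mathbb K$ be the Euclidean volume of the convex hull of the columns of $\mathbf M$, i.e. the series whose value at every large $t$ is the volume of the real polytope $\mathrm{conv}(\mathbf M(t))$. The tropical (upper) dequantized volume of $M$ is $$\mathrm{qtvol}^+(M)=\sup\{\mathrm{val}\,\mathrm{vol}\,\mathbf M:\ \mathbf M\in\mathbb K^{d\times m},\ \mathrm{val}\,\mathbf M=M\},$$ where $\mathrm{val}\,\mathbf M$ is taken entrywise. Then for every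 $i\in\{1,\dots,d\}$ $$\mathrm{tbvol}_i^-(P)\le \mathrm{tminor}_i(M),$$ and moreover $\mathrm{tbvol}(P)\le \mathrm{qtvol}^+(M)$. -/

import Mathlib

open Filter MeasureTheory

namespace TropVol

noncomputable section

/-! ### The max-plus semiring and tropical polytopes -/

/-- The max-tropical semiring `ℝ ∪ {-∞}`: tropical addition is `⊔`, tropical multiplication is
`+` (with `⊥ + a = ⊥`), the tropical zero is `⊥` and the tropical one is `0`.
Mathlib's topology on it is the order topology, the usual one of `[-∞, ∞)`. -/
abbrev T : Type := WithBot ℝ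

/-- The inclusion of `ℝ ∪ {-∞}` into the extended reals. -/
def toE (a : T) : EReal := WithBot.recBotCoe ⊥ (fun r : ℝ => (r : EReal)) a

/-- The tropical convex hull: all points `⨁ⱼ λⱼ ⊙ vⱼ` with finitely many `vⱼ ∈ V` and
`⨁ⱼ λⱼ = 0`. -/
def tconv {d : ℕ} (V : Set (Fin d → T)) : Set (Fin d → T) :=
  {x | ∃ (n : ℕ) (c : Fin n → T) (v : Fin n → Fin d → T),
    (∀ j, v j ∈ V) ∧ Finset.univ.sup c = 0 ∧ ∀ k, x k = Finset.univ.sup fun j => c j + v j k}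

/-- The set of columns of a matrix. -/
def cols {d m : ℕ} (M : Matrix (Fin d) (Fin m) T) : Set (Fin d → T) :=
  Set.range fun j k => M k j

/-- The vertices (extreme points) of `P`, the points of `P` that are not tropical convex
combinations of other points of `P`; they form the minimal generating set of a tropical
polytope. -/
def vertices {d : ℕ} (P : Set (Fin d → T)) : Set (Fin d → T) :=
  {v | v ∈ P ∧ v ∉ tconv (P \ {v})}

/-! ### The covector decomposition and trunks -/

/-- Homogenization: prepend the coordinate `0` (with index `none`). -/
def homog {d : ℕ} (x : Fin d → T) : Option (Fin d) → T := fun k => k.elim 0 x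

/-- The covector (type) of `x` with respect to the generators `V`. To a coordinate `k` of the
homogenized point with `x k ≠ -∞` it assigns the set of those `v ∈ V` for which some (hence the
largest) tropical multiple `c ⊙ v ≤ x` agrees with `x` at `k`. -/
def covector {d : ℕ} (V : Set (Fin d → T)) (x : Fin d → T) (k : Option (Fin d)) :
    Set (Fin d → T) :=
  {v | v ∈ V ∧ homog x k ≠ ⊥ ∧
    ∃ c : T, (∀ l, c + homog v l ≤ homog x l) ∧ c + homog v k = homog x k}

/-- The (relatively open) cells of the covector decomposition of `P` : the nonempty sets of
all points of `P` with a given covector with respect to the vertices of `P`. -/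
def cells {d : ℕ} (P : Set (Fin d → T)) : Set (Set (Fin d → T)) :=
  {F | ∃ x ∈ P, F = {y | y ∈ P ∧ covector (vertices P) y = covector (vertices P) x}}

/-- The dimension of a cell `F`. All points of a cell have the same infinite coordinates; these
are replaced by `0`, and the dimension of the affine hull is taken. -/
def cellDim {d : ℕ} (F : Set (Fin d → T)) : ℕ :=
  Module.finrank ℝ (vectorSpan ℝ ((fun (x : Fin d → T) (k : Fin d) => (x k).unbotD 0) '' F))

/-- The `i`-trunk: the union of all cells that lie in the closure of a cell of dimension at
least `i`. -/
def trunk {d : ℕ} (i : ℕ) (P : Set (Fin d → T)) : Set (Fin d → T) :=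
  ⋃₀ {F | F ∈ cells P ∧ ∃ G ∈ cells P, i ≤ cellDim G ∧ F ⊆ closure G}

/-! ### Barycentric volumes -/

/-- The tropical barycentric volume, the maximum of `x₁ + ⋯ + x_d` over the `d`-trunk
(`-∞` if the `d`-trunk is empty). -/
def tbvol {d : ℕ} (P : Set (Fin d → T)) : EReal :=
  ⨆ x ∈ trunk d P, toE (∑ k, x k)

/-- The tropical lower barycentric `i`-volume: the maximum over the `i`-trunk of the smallest
sum of `i` distinct coordinates (`-∞` if the `i`-trunk is empty). -/
def tbvolLower {d : ℕ} (i : ℕ) (P : Set (Fin d → T)) : EReal :=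
  ⨆ x ∈ trunk i P, ⨅ I ∈ {I : Finset (Fin d) | I.card = i}, toE (∑ k ∈ I, x k)

/-! ### Tropical minors -/

/-- The tropical determinant. -/
def tdet {n : ℕ} (A : Matrix (Fin n) (Fin n) T) : T :=
  Finset.univ.sup fun σ : Equiv.Perm (Fin n) => ∑ k, A k (σ k)

/-- The maximal tropical `i`-minor, the maximum of the tropical determinants of all `i × i`
submatrices (`-∞` if there are none). -/
def tminor {d m : ℕ} (i : ℕ) (M : Matrix (Fin d) (Fin m) T) : T :=
  Finset.univ.sup fun I : {I : Finset (Fin d) // I.card = i} =>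
    Finset.univ.sup fun J : {J : Finset (Fin m) // J.card = i} =>
      tdet (M.submatrix (I.1.orderEmbOfFin I.2) (J.1.orderEmbOfFin J.2))

/-! ### Puiseux series and the dequantized volume -/

/-- Absolutely convergent generalized real Puiseux series `∑ c_α t^α` in a large parameter `t` :
real exponents, only finitely many of them above any given bound, and absolute convergence for
some (hence for every sufficiently large) `t > 0`. -/
structure PuiseuxSeries where
  coeff : ℝ → ℝ
  finite_above : ∀ r : ℝ, {α : ℝ | coeff α ≠ 0 ∧ r ≤ α}.Finite
  convergent : ∃ t : ℝ, 0 < t ∧ Summable fun α : ℝ => |coeff α| * t ^ α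

/-- The value of a series at the parameter `t`. -/
def PuiseuxSeries.eval (f : PuiseuxSeries) (t : ℝ) : ℝ := ∑' α : ℝ, f.coeff α * t ^ α

/-- The valuation: the largest exponent of the series, and `-∞` for the zero series. -/
def PuiseuxSeries.val (f : PuiseuxSeries) : EReal :=
  ⨆ α ∈ {α : ℝ | f.coeff α ≠ 0}, (α : EReal)

/-- `v` is the Euclidean volume of the convex hull of the columns of the matrix `L` over the
field of Puiseux series: for all large `t`, `v` evaluates at `t` to the volume of
the real polytope spanned by the columns of `L` evaluated at `t`. -/
def IsVol {d m : ℕ} (L : Matrix (Fin d) (Fin m) PuiseuxSeries) (v : PuiseuxSeries) : Prop :=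
  ∀ᶠ t : ℝ in atTop, v.eval t =
    (volume (convexHull ℝ (Set.range fun (j : Fin m) (k : Fin d) => (L k j).eval t))).toReal

/-- The tropical (upper) dequantized volume of `M`, the supremum of the valuations of the volumes
of all lifts of `M` to Puiseux series. -/
def qtvol {d m : ℕ} (M : Matrix (Fin d) (Fin m) T) : EReal :=
  sSup {a | ∃ (L : Matrix (Fin d) (Fin m) PuiseuxSeries) (v : PuiseuxSeries),
    (∀ k j, (L k j).val = toE (M k j)) ∧ IsVol L v ∧ a = v.val}

end

end TropVol

/-! Both inequalities rest on a transversal extracted from a cell (`exists_transversal`). Join two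
homogenized coordinates whenever some vertex attains the cell's points at both, and join infinite
coordinates to the homogenizing one. Within the cell, displacements are constant on each class and
vanish on the class of `none`, so a cell of dimension at least `i` has `i` further classes. One
coordinate per class, with a vertex attaining it, gives `i` rows and `i` distinct columns, and a
vertex attaining `none` gives one more column. The scalars involved are at most `0`, so each chosen
coordinate is bounded by a matrix entry, on the closure too. Summing gives `tbvolLower_le_tminor`.

For `i = d` the extra column forces `d < m`. Take a maximal transversal `g` and a column `j₀` that
it misses. The monomial lift in `optimal_transversal_le_qtvol` has signs and sizes chosen so that
all columns lie in the simplex on `j₀` and the columns of `g`: the square matrix `S` along `g` has a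
dominant diagonal and nonpositive off-diagonal entries, hence a nonnegative inverse
(`nonneg_of_mulVec_nonneg`). The volume is then a constant times a determinant polynomial in `t`,
bounded below by the product along `g`, which bounds its degree (`volume_convexHull_lift`,
`le_natDegree_of_pow_le`). -/

namespace TropVol

/-! ### Covectors, vertices and the transversal of a cell. -/

section Covectors

variable {d m : ℕ}

theorem add_right_cancel_of_ne_bot {a b c : T} (h : a + c = b + c) (hc : c ≠ ⊥) : a = b := by
  cases c using WithBot.recBotCoe with
  | bot => exact absurd rfl hc
  | coe c =>
    cases a using WithBot.recBotCoe <;> cases b using WithBot.recBotCoe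
    · rfl
    · exact absurd h.symm (WithBot.coe_ne_bot (a := _ + c))
    · exact absurd h (WithBot.coe_ne_bot (a := _ + c))
    · norm_cast at h ⊢
      exact add_right_cancel h

theorem le_of_add_le_add_right_of_ne_bot {a b c : T} (h : a + c ≤ b + c) (hc : c ≠ ⊥) :
    a ≤ b := by
  rcases le_total a b with h' | h'
  · exact h'
  · exact (add_right_cancel_of_ne_bot (h.antisymm (by gcongr)) hc).le

theorem homog_injective : Function.Injective (homog (d := d)) := fun _ _ h =>
  funext fun k => congrFun h (some k)

/-- Each finite coordinate of a tropical combination is attained by one of the points. -/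
theorem exists_attaining {V : Set (Fin d → T)} {x : Fin d → T} (hx : x ∈ tconv V)
    (k : Option (Fin d)) :
    ∃ v ∈ V, ∃ c : T, (∀ l, c + homog v l ≤ homog x l) ∧ c + homog v k = homog x k := by
  obtain ⟨n, c, v, hv, hc, hk⟩ := hx
  have hh : ∀ l, homog x l = Finset.univ.sup fun j => c j + homog (v j) l := by
    rintro (_ | l)
    · simpa [homog] using hc.symm
    · exact hk l
  have hn : (Finset.univ : Finset (Fin n)).Nonempty := by
    rcases Finset.eq_empty_or_nonempty (Finset.univ : Finset (Fin n)) with h | h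
    · rw [h, Finset.sup_empty] at hc
      exact absurd hc WithBot.bot_ne_zero
    · exact h
  obtain ⟨j, -, hj⟩ := Finset.exists_mem_eq_sup _ hn fun j => c j + homog (v j) k
  refine ⟨v j, hv j, c j, fun l => ?_, by rw [hh k, hj]⟩
  rw [hh l]
  exact Finset.le_sup (f := fun j => c j + homog (v j) l) (Finset.mem_univ j)

theorem subset_tconv (V : Set (Fin d → T)) : V ⊆ tconv V := fun v hv =>
  ⟨1, fun _ => 0, fun _ => v, fun _ => hv, by simp, by simp⟩

/-- A point that is not a column is a combination of columns, all of them different from it, so it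
is not extreme. -/
theorem vertices_subset_cols (M : Matrix (Fin d) (Fin m) T) :
    vertices (tconv (cols M)) ⊆ cols M := by
  rintro v ⟨⟨n, c, w, hw, h⟩, hv⟩
  by_contra hcon
  exact hv ⟨n, c, w, fun j => ⟨subset_tconv _ (hw j), fun e => hcon (e ▸ hw j)⟩, h⟩

/-- A point of a tropical polytope attains each finite coordinate on some vertex. -/
theorem covector_nonempty {M : Matrix (Fin d) (Fin m) T} {y : Fin d → T}
    (hy : y ∈ tconv (cols M)) {k : Option (Fin d)} (hk : homog y k ≠ ⊥) :
    (covector (vertices (tconv (cols M))) y k).Nonempty := by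
  -- The multiples of columns that lie below `y` and touch it at `k`. Each column contributes at
  -- most one, since touching at `k` fixes the scalar; a minimal element will come from a vertex.
  set s : Set (Option (Fin d) → T) := {w | ∃ j : Fin m, ∃ c : T,
    w = (fun l => c + homog (fun i => M i j) l) ∧ (∀ l, w l ≤ homog y l) ∧ w k = homog y k}
    with hs
  have hfin : s.Finite := by
    rw [hs, Set.ofPred_exists]
    refine Set.finite_iUnion fun j => Set.Subsingleton.finite ?_
    rintro _ ⟨c, rfl, -, h⟩ _ ⟨c', rfl, -, h'⟩
    have hne : homog (fun i => M i j) k ≠ ⊥ := by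
      intro e
      simp only [e, WithBot.add_bot] at h
      exact hk h.symm
    rw [add_right_cancel_of_ne_bot (h.trans h'.symm) hne]
  have hne : s.Nonempty := by
    obtain ⟨_, ⟨j, rfl⟩, c, h1, h2⟩ := exists_attaining hy k
    exact ⟨_, j, c, rfl, h1, h2⟩
  obtain ⟨w, ⟨⟨j, c, rfl, h1, h2⟩, hmin⟩⟩ := hfin.exists_minimal hne
  have hc : c ≠ ⊥ := by
    rintro rfl
    simp only [WithBot.bot_add] at h2
    exact hk h2.symm
  refine ⟨fun i => M i j, ⟨subset_tconv _ ⟨j, rfl⟩, fun hcon => ?_⟩, hk, c, h1, h2⟩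
  -- If the column were not extreme, another point `u` of the polytope would touch it at `k`, and a
  -- column would in turn touch `u` there. Minimality collapses this chain, so a multiple of `u`
  -- equals the column; the coordinate `none` makes that multiple trivial.
  obtain ⟨u, ⟨hu, hune⟩, c₁, h3, h4⟩ := exists_attaining hcon k
  obtain ⟨_, ⟨j₂, rfl⟩, c₂, h5, h6⟩ := exists_attaining hu k
  have hle : ∀ l, c₁ + c₂ + homog (fun i => M i j₂) l ≤ c₁ + homog u l := by
    intro l
    rw [add_assoc]
    exact add_le_add_right (h5 l) _
  have hle' : ∀ l, c + (c₁ + c₂) + homog (fun i => M i j₂) l ≤ c + homog (fun i => M i j) l := by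
    intro l
    rw [add_assoc]
    exact add_le_add_right ((hle l).trans (h3 l)) _
  have hmem : (fun l => c + (c₁ + c₂) + homog (fun i => M i j₂) l) ∈ s := by
    refine ⟨j₂, _, rfl, fun l => (hle' l).trans (h1 l), ?_⟩
    simp only
    rw [← h2, add_assoc, add_assoc, h6, h4]
  have hge := hmin hmem hle'
  have heq : ∀ l, c₁ + homog u l = homog (fun i => M i j) l := by
    intro l
    refine (h3 l).antisymm (le_trans ?_ (hle l))
    have := hge l
    simp only [add_assoc c] at this
    rw [add_comm c, add_comm c] at this
    exact le_of_add_le_add_right_of_ne_bot this hc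
  have hc1 : c₁ = 0 := by simpa [homog] using heq none
  refine hune (homog_injective (funext fun l => ?_))
  rw [← heq l, hc1, zero_add]

theorem homog_ne_bot_of_mem_covector {V : Set (Fin d → T)} {y v : Fin d → T}
    {k : Option (Fin d)} (h : v ∈ covector V y k) : homog v k ≠ ⊥ := by
  obtain ⟨-, h1, c, -, h2⟩ := h
  intro e
  rw [e, WithBot.add_bot] at h2
  exact h1 h2.symm

/-- The homogenizing coordinate is `0` for both points, which forces the scalar to be at most `0`.
-/
theorem le_of_mem_covector {V : Set (Fin d → T)} {y v : Fin d → T} {k : Fin d}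
    (h : v ∈ covector V y (some k)) : y k ≤ v k := by
  obtain ⟨-, -, c, h1, h2⟩ := h
  have hc : c ≤ 0 := by simpa [homog] using h1 none
  calc y k = c + v k := h2.symm
    _ ≤ 0 + v k := by gcongr
    _ = v k := zero_add _

/-- The scalar attaining equality at a coordinate is the largest admissible one, hence the same for
both coordinates. This makes displacements within a cell agree on them. -/
theorem exists_scalar_of_mem_covector {V : Set (Fin d → T)} {y v : Fin d → T}
    {k l : Option (Fin d)} (hk : v ∈ covector V y k) (hl : v ∈ covector V y l) :
    ∃ c : ℝ, homog y k = c + homog v k ∧ homog y l = c + homog v l := by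
  have hvk := homog_ne_bot_of_mem_covector hk
  have hvl := homog_ne_bot_of_mem_covector hl
  obtain ⟨-, hyk, c, h1, h2⟩ := hk
  obtain ⟨-, hyl, c', h1', h2'⟩ := hl
  have hcc : c = c' := by
    apply le_antisymm
    · exact le_of_add_le_add_right_of_ne_bot ((h1 l).trans h2'.ge) hvl
    · exact le_of_add_le_add_right_of_ne_bot ((h1' k).trans h2.ge) hvk
  subst hcc
  cases c using WithBot.recBotCoe with
  | bot => rw [WithBot.bot_add] at h2; exact absurd h2.symm hyk
  | coe c => exact ⟨c, h2.symm, h2'.symm⟩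

theorem unbotD_sub_unbotD {c c' : ℝ} {a b v : T} (hv : v ≠ ⊥) (ha : a = c + v)
    (hb : b = c' + v) : a.unbotD 0 - b.unbotD 0 = c - c' := by
  cases v using WithBot.recBotCoe with
  | bot => exact absurd rfl hv
  | coe v =>
    subst ha hb
    rw [← WithBot.coe_add, ← WithBot.coe_add, WithBot.unbotD_coe, WithBot.unbotD_coe]
    ring

/-- A cell of dimension at least `i` has `i` coordinates which are bounded on its closure by
entries of `M` in different columns, avoiding some further column. -/
theorem exists_transversal {M : Matrix (Fin d) (Fin m) T} {i : ℕ} {G : Set (Fin d → T)}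
    (hG : G ∈ cells (tconv (cols M))) (hi : i ≤ cellDim G) :
    ∃ (K : Fin i → Fin d) (J : Fin i → Fin m) (j₀ : Fin m), Function.Injective K ∧
      Function.Injective J ∧ j₀ ∉ Set.range J ∧ (∀ t, M (K t) (J t) ≠ ⊥) ∧
      ∀ x ∈ closure G, ∀ t, x (K t) ≤ M (K t) (J t) := by
  obtain ⟨x₀, hx₀, rfl⟩ := hG
  set V := vertices (tconv (cols M)) with hV
  set r : Option (Fin d) → Option (Fin d) → Prop := fun k l =>
    (homog x₀ k = ⊥ ∧ l = none) ∨ ∃ v, v ∈ covector V x₀ k ∧ v ∈ covector V x₀ l with hr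
  have : Finite (Quot r) := Finite.of_surjective _ Quot.mk_surjective
  have := Fintype.ofFinite {q : Quot r // q ≠ Quot.mk r none}
  classical
  -- Displacements that are constant on classes and zero on the class of `none`; the range contains
  -- the direction space of the cell.
  let Ψ : ({q : Quot r // q ≠ Quot.mk r none} → ℝ) →ₗ[ℝ] (Fin d → ℝ) :=
    { toFun := fun a k => if h : Quot.mk r (some k) = Quot.mk r none then 0 else a ⟨_, h⟩
      map_add' := fun a b => by
        funext k; by_cases h : Quot.mk r (some k) = Quot.mk r none <;> simp [h]
      map_smul' := fun a b => by
        funext k; by_cases h : Quot.mk r (some k) = Quot.mk r none <;> simp [h] }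
  have hspan : vectorSpan ℝ ((fun (x : Fin d → T) (k : Fin d) => (x k).unbotD 0) ''
      {y | y ∈ tconv (cols M) ∧ covector V y = covector V x₀}) ≤ LinearMap.range Ψ := by
    rw [vectorSpan_eq_span_vsub_set_right ℝ (Set.mem_image_of_mem _ (show x₀ ∈ {y | y ∈ tconv (cols M) ∧
        covector V y = covector V x₀} from ⟨hx₀, rfl⟩)), Submodule.span_le]
    rintro _ ⟨_, ⟨y, ⟨hy, hcov⟩, rfl⟩, rfl⟩
    set F : Option (Fin d) → ℝ := fun o => (homog y o).unbotD 0 - (homog x₀ o).unbotD 0 with hF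
    have hF0 : F none = 0 := by simp [hF, homog]
    have hFr : ∀ k l, r k l → F k = F l := by
      rintro k l (⟨hk, rfl⟩ | ⟨v, hk, hl⟩)
      · have hyk : homog y k = ⊥ := by
          by_contra hcon
          obtain ⟨v, hv⟩ := covector_nonempty hy hcon
          rw [← hV, hcov] at hv
          exact hv.2.1 hk
        rw [hF0]
        simp only [hF]
        rw [hk, hyk, sub_self]
      · obtain ⟨c, h1, h2⟩ := exists_scalar_of_mem_covector hk hl
        obtain ⟨c', h3, h4⟩ := exists_scalar_of_mem_covector (y := y) (V := V)
          (by rw [hcov]; exact hk) (by rw [hcov]; exact hl)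
        simp only [hF]
        rw [unbotD_sub_unbotD (homog_ne_bot_of_mem_covector hk) h3 h1,
          unbotD_sub_unbotD (homog_ne_bot_of_mem_covector hl) h4 h2]
    refine ⟨fun q => Quot.lift F hFr q.1, funext fun k => ?_⟩
    change (if h : Quot.mk r (some k) = Quot.mk r none then (0 : ℝ) else F (some k)) = F (some k)
    split_ifs with h
    · exact (hF0.symm.trans (congrArg (Quot.lift F hFr) h).symm)
    · rfl
  have hcard : i ≤ Fintype.card {q : Quot r // q ≠ Quot.mk r none} := by
    refine hi.trans ((Submodule.finrank_mono hspan).trans ?_)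
    exact (LinearMap.finrank_range_le Ψ).trans (by simp)
  obtain ⟨e⟩ : Nonempty (Fin i ↪ {q : Quot r // q ≠ Quot.mk r none}) :=
    Function.Embedding.nonempty_of_card_le (by simpa using hcard)
  have hex : ∀ t : Fin i, ∃ (k : Fin d) (j : Fin m), Quot.mk r (some k) = (e t).1 ∧
      (fun l => M l j) ∈ covector V x₀ (some k) := by
    intro t
    obtain ⟨o, ho⟩ := Quot.exists_rep (e t).1
    rcases o with _ | k
    · exact absurd ho.symm (e t).2
    have hne : homog x₀ (some k) ≠ ⊥ := fun h =>
      (e t).2 (ho.symm.trans (Quot.sound (Or.inl ⟨h, rfl⟩)))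
    obtain ⟨v, hv⟩ := covector_nonempty hx₀ hne
    obtain ⟨j, rfl⟩ := vertices_subset_cols M hv.1
    exact ⟨k, j, ho, hv⟩
  choose K J hK hJ using hex
  obtain ⟨v₀, hv₀⟩ := covector_nonempty hx₀ (k := none) (by simp [homog])
  obtain ⟨j₀, rfl⟩ := vertices_subset_cols M hv₀.1
  refine ⟨K, J, j₀, fun s t h => ?_, fun s t h => ?_, ?_, fun t => ?_, fun x hx t => ?_⟩
  · exact e.injective (Subtype.ext ((hK s).symm.trans ((congrArg _ (congrArg _ h)).trans (hK t))))
  · refine e.injective (Subtype.ext ((hK s).symm.trans (Eq.trans ?_ (hK t))))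
    exact Quot.sound (Or.inr ⟨_, hJ s, h ▸ hJ t⟩)
  · rintro ⟨t, rfl⟩
    exact (e t).2 ((hK t).symm.trans (Quot.sound (Or.inr ⟨_, hJ t, hv₀⟩)))
  · exact homog_ne_bot_of_mem_covector (hJ t)
  · have hcl : IsClosed {x : Fin d → T | x (K t) ≤ M (K t) (J t)} :=
      isClosed_Iic.preimage (continuous_apply (K t))
    refine closure_minimal ?_ hcl hx
    rintro y ⟨-, hy⟩
    exact le_of_mem_covector (v := fun l => M l (J t)) (V := V) (by rw [hy]; exact hJ t)

end Covectors

/-! ### Bounding the lower barycentric volume by minors. -/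

section Minors

variable {d m : ℕ}

/-- `K` and `J` differ from the increasing enumerations of their images by permutations, so the sum
is one term of a tropical determinant. -/
theorem sum_le_tminor {i : ℕ} (M : Matrix (Fin d) (Fin m) T) {K : Fin i → Fin d}
    {J : Fin i → Fin m} (hK : Function.Injective K) (hJ : Function.Injective J) :
    ∑ t, M (K t) (J t) ≤ tminor i M := by
  classical
  have key : ∀ {n : ℕ} {f : Fin i → Fin n} (hf : Function.Injective f),
      ∃ (I : {I : Finset (Fin n) // I.card = i}) (a : Equiv.Perm (Fin i)),
        ∀ t, I.1.orderEmbOfFin I.2 (a t) = f t := by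
    intro n f hf
    have hI : (Finset.univ.image f).card = i := by simp [Finset.card_image_of_injective _ hf]
    have hex : ∀ t, ∃ s, (Finset.univ.image f).orderEmbOfFin hI s = f t := by
      intro t
      have : f t ∈ Set.range ((Finset.univ.image f).orderEmbOfFin hI) := by
        rw [Finset.range_orderEmbOfFin]; simp
      exact this
    choose a ha using hex
    have hai : Function.Injective a := fun s t h => hf (by rw [← ha, ← ha, h])
    exact ⟨⟨_, hI⟩, Equiv.ofBijective a (Finite.injective_iff_bijective.1 hai), ha⟩
  obtain ⟨I, a, ha⟩ := key hK
  obtain ⟨I', b, hb⟩ := key hJ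
  refine le_trans ?_ (Finset.le_sup (f := fun I : {I : Finset (Fin d) // I.card = i} => _)
    (Finset.mem_univ I))
  refine le_trans ?_ (Finset.le_sup (f := fun J : {J : Finset (Fin m) // J.card = i} => _)
    (Finset.mem_univ I'))
  refine le_trans (le_of_eq ?_) (Finset.le_sup (f := fun σ : Equiv.Perm (Fin i) => _)
    (Finset.mem_univ (a.symm.trans b)))
  rw [← Equiv.sum_comp a fun k => M.submatrix (I.1.orderEmbOfFin I.2)
    (I'.1.orderEmbOfFin I'.2) k ((a.symm.trans b) k)]
  refine Finset.sum_congr rfl fun t _ => ?_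
  simp [ha, hb]

theorem toE_mono : Monotone toE := by
  intro a b h
  cases a using WithBot.recBotCoe with
  | bot => exact bot_le
  | coe a =>
    cases b using WithBot.recBotCoe with
    | bot => exact absurd h (by simp)
    | coe b => exact EReal.coe_le_coe_iff.2 (WithBot.coe_le_coe.1 h)

theorem tbvolLower_le_tminor (M : Matrix (Fin d) (Fin m) T) (i : ℕ) :
    tbvolLower i (tconv (cols M)) ≤ toE (tminor i M) := by
  classical
  refine iSup₂_le ?_
  rintro x ⟨F, ⟨-, G, hG, hi, hFG⟩, hx⟩
  obtain ⟨K, J, -, hK, hJ, -, -, hle⟩ := exists_transversal hG hi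
  refine (iInf₂_le (Finset.univ.image K) ?_).trans (toE_mono ?_)
  · simp [Finset.card_image_of_injective _ hK]
  · rw [Finset.sum_image fun a _ b _ h => hK h]
    exact (Finset.sum_le_sum fun t _ => hle x (hFG hx) t).trans (sum_le_tminor M hK hJ)

end Minors

/-! ### Determinants dominated by the diagonal product, and inverse positivity. -/

section DominantDiagonal

variable {n : Type*} [Fintype n] [DecidableEq n]

/-- If the identity permutation dominates the Leibniz expansion, the determinant is bounded below
by a multiple of the diagonal product. -/
theorem le_det_of_diag_dominant (B : Matrix n n ℝ) {ε : ℝ} (hε : 0 ≤ ε)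
    (hd : 0 ≤ ∏ k, B k k)
    (h : ∀ σ : Equiv.Perm n, σ ≠ 1 → ∏ k, |B (σ k) k| ≤ ε * ∏ k, B k k) :
    (1 - (Fintype.card n).factorial * ε) * ∏ k, B k k ≤ B.det := by
  rw [Matrix.det_apply, ← Finset.add_sum_erase _ _ (Finset.mem_univ (1 : Equiv.Perm n))]
  have h1 : -(∑ σ ∈ Finset.univ.erase (1 : Equiv.Perm n), ε * ∏ k, B k k) ≤
      ∑ σ ∈ Finset.univ.erase (1 : Equiv.Perm n), Equiv.Perm.sign σ • ∏ i, B (σ i) i := by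
    rw [← Finset.sum_neg_distrib]
    refine Finset.sum_le_sum fun σ hσ => ?_
    have := h σ (Finset.ne_of_mem_erase hσ)
    rw [← Finset.abs_prod] at this
    have h2 := abs_le.1 this
    rcases Int.units_eq_one_or (Equiv.Perm.sign σ) with h3 | h3 <;> rw [h3] <;> simp <;> linarith
  have h2 : (∑ σ ∈ Finset.univ.erase (1 : Equiv.Perm n), ε * ∏ k, B k k) ≤
      (Fintype.card n).factorial * (ε * ∏ k, B k k) := by
    rw [Finset.sum_const, nsmul_eq_mul]
    refine mul_le_mul_of_nonneg_right ?_ (mul_nonneg hε hd)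
    rw [← Fintype.card_perm (α := n)]
    exact_mod_cast Finset.card_le_univ _
  simp only [Equiv.Perm.sign_one, one_smul, Equiv.Perm.one_apply]
  nlinarith

/-- A matrix with nonpositive off-diagonal entries and dominant diagonal is inverse-positive. -/
theorem nonneg_of_mulVec_nonneg (A : Matrix n n ℝ) {ε : ℝ} (hε : 0 ≤ ε)
    (hε1 : (Fintype.card n).factorial * ε < 1) (hdiag : ∀ k, 0 < A k k)
    (hoff : ∀ k l, k ≠ l → A k l ≤ 0)
    (h : ∀ σ : Equiv.Perm n, σ ≠ 1 → ∏ k, |A (σ k) k| ≤ ε * ∏ k, A k k)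
    (x : n → ℝ) (hx : ∀ k, 0 ≤ (A.mulVec x) k) (k : n) : 0 ≤ x k := by
  classical
  by_contra hneg
  push Not at hneg
  set q : n → ℝ := fun k => ∑ l, if x l < 0 then A k l * x l else 0 with hq
  have hqn : ∀ k, x k < 0 → 0 ≤ q k := by
    intro k hk
    refine (hx k).trans ?_
    rw [Matrix.mulVec, dotProduct]
    refine Finset.sum_le_sum fun l _ => ?_
    split_ifs with hl
    · exact le_rfl
    · have : k ≠ l := by rintro rfl; exact hl hk
      exact mul_nonpos_of_nonpos_of_nonneg (hoff k l this) (not_lt.1 hl)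
  -- `B` keeps the block of negative indices, with diagonal raised just enough that `B` annihilates
  -- the negative part of `x`. Raising the diagonal preserves the domination, so `B.det` is
  -- positive, a contradiction.
  set B : Matrix n n ℝ := fun k l =>
    if k = l then (if x k < 0 then A k k - q k / x k else A k k)
    else if x k < 0 ∧ x l < 0 then A k l else 0 with hB
  have hBd : ∀ k, A k k ≤ B k k := by
    intro k
    simp only [hB, if_true]
    split_ifs with hk
    · have := div_nonpos_of_nonneg_of_nonpos (hqn k hk) hk.le
      linarith
    · exact le_rfl
  have hBo : ∀ k l, k ≠ l → |B k l| ≤ |A k l| := by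
    intro k l hkl
    simp only [hB, if_neg hkl]
    split_ifs
    · exact le_rfl
    · simp
  have hBp : ∀ k, 0 < B k k := fun k => (hdiag k).trans_le (hBd k)
  have hdet : 0 < B.det := by
    have hp : 0 < ∏ k, B k k := Finset.prod_pos fun k _ => hBp k
    refine lt_of_lt_of_le ?_ (le_det_of_diag_dominant B hε hp.le fun σ hσ => ?_)
    · exact mul_pos (by linarith) hp
    · calc ∏ k, |B (σ k) k| ≤ ∏ k, (B k k / A k k) * |A (σ k) k| := by
            refine Finset.prod_le_prod (fun _ _ => abs_nonneg _) fun k _ => ?_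
            by_cases hk : σ k = k
            · rw [hk, abs_of_pos (hBp k), abs_of_pos (hdiag k), div_mul_cancel₀ _ (hdiag k).ne']
            · refine (hBo _ _ hk).trans (le_mul_of_one_le_left (abs_nonneg _) ?_)
              rw [one_le_div (hdiag k)]
              exact hBd k
        _ = (∏ k, B k k / A k k) * ∏ k, |A (σ k) k| := Finset.prod_mul_distrib
        _ ≤ (∏ k, B k k / A k k) * (ε * ∏ k, A k k) :=
            mul_le_mul_of_nonneg_left (h σ hσ)
              (Finset.prod_nonneg fun k _ => (div_pos (hBp k) (hdiag k)).le)
        _ = ε * ∏ k, B k k := by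
            rw [Finset.prod_div_distrib]
            have : ∏ k, A k k ≠ 0 := (Finset.prod_pos fun k _ => hdiag k).ne'
            field_simp
  refine hdet.ne' (Matrix.exists_mulVec_eq_zero_iff.1
    ⟨fun l => if x l < 0 then x l else 0, fun h0 => ?_, ?_⟩)
  · have := congrFun h0 k
    simp [hneg] at this
    exact hneg.ne this
  · funext k
    rw [Matrix.mulVec, dotProduct, Pi.zero_apply]
    by_cases hk : x k < 0
    · have h1 : ∀ l, B k l * (if x l < 0 then x l else 0) =
          (if x l < 0 then A k l * x l else 0) - if k = l then q k else 0 := by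
        intro l
        by_cases hkl : k = l
        · subst hkl
          simp only [hB, hk, if_true]
          field_simp [hk.ne]
        · simp only [hB, hkl, if_false, hk, true_and]
          split_ifs <;> simp
      rw [Finset.sum_congr rfl fun l _ => h1 l, Finset.sum_sub_distrib]
      simp [hq]
    · refine Finset.sum_eq_zero fun l _ => ?_
      by_cases hl : x l < 0
      · have hkl : k ≠ l := by rintro rfl; exact hk hl
        simp [hB, hk, hkl]
      · simp [hl]

end DominantDiagonal

/-! ### Volume of a simplex containing all the points. -/

section Simplex

open scoped Pointwise

variable {d : ℕ}

/-- The corner simplex `x ≥ 0`, `∑ x ≤ 1`. -/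
def cornerSimplex (d : ℕ) : Set (Fin d → ℝ) := {x | (∀ k, 0 ≤ x k) ∧ ∑ k, x k ≤ 1}

theorem convex_cornerSimplex : Convex ℝ (cornerSimplex d) := by
  rintro x ⟨hx, hx1⟩ y ⟨hy, hy1⟩ a b ha hb hab
  refine ⟨fun k => ?_, ?_⟩
  · have := hx k
    have := hy k
    simp only [Pi.add_apply, Pi.smul_apply, smul_eq_mul]
    positivity
  · simp only [Pi.add_apply, Pi.smul_apply, smul_eq_mul, Finset.sum_add_distrib,
      ← Finset.mul_sum]
    nlinarith

theorem volume_cornerSimplex_toReal_pos (hd : 1 ≤ d) :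
    0 < (volume (cornerSimplex d)).toReal := by
  have hd0 : (0 : ℝ) < d := by exact_mod_cast hd
  refine ENNReal.toReal_pos (ne_of_gt ?_) (ne_of_lt ?_)
  · have hsub : Set.Icc (0 : Fin d → ℝ) (fun _ => 1 / (d : ℝ)) ⊆ cornerSimplex d := by
      intro x hx
      refine ⟨hx.1, (Finset.sum_le_sum fun k _ => hx.2 k).trans ?_⟩
      simp [hd0.ne']
    refine lt_of_lt_of_le ?_ (measure_mono hsub)
    rw [Real.volume_Icc_pi]
    refine pos_iff_ne_zero.2 (Finset.prod_ne_zero_iff.2 fun k _ => ?_)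
    simp [hd0]
  · have hsub : cornerSimplex d ⊆ Set.Icc (0 : Fin d → ℝ) 1 := by
      rintro x ⟨hx, hx1⟩
      exact ⟨hx, fun k => (Finset.single_le_sum (fun l _ => hx l) (Finset.mem_univ k)).trans hx1⟩
    refine (measure_mono hsub).trans_lt ?_
    rw [Real.volume_Icc_pi]
    simp

/-- If all points of a family are in the simplex spanned by `s₀, s₁, …, s_d` in the family, then
the convex hull has the volume of that simplex. -/
theorem volume_convexHull_eq_of_subset_simplex {ι : Type*} (p : ι → Fin d → ℝ) (j₀ : ι)
    (g : Fin d → ι)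
    (h : ∀ j, ∃ x ∈ cornerSimplex d, p j = p j₀ + ∑ l, x l • (p (g l) - p j₀)) :
    (volume (convexHull ℝ (Set.range p))).toReal =
      |(Matrix.of fun k l => p (g l) k - p j₀ k).det| * (volume (cornerSimplex d)).toReal := by
  set A : Matrix (Fin d) (Fin d) ℝ := Matrix.of fun k l => p (g l) k - p j₀ k with hA
  have hAx : ∀ x, Matrix.toLin' A x = ∑ l, x l • (p (g l) - p j₀) := by
    intro x
    ext k
    simp [hA, Matrix.mulVec, dotProduct, mul_comm]
  have hull : convexHull ℝ (Set.range p) = p j₀ +ᵥ (Matrix.toLin' A '' cornerSimplex d) := by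
    apply Set.Subset.antisymm
    · refine convexHull_min ?_ ((convex_cornerSimplex.linear_image _).vadd _)
      rintro _ ⟨j, rfl⟩
      obtain ⟨x, hx, hj⟩ := h j
      exact ⟨_, ⟨x, hx, rfl⟩, by rw [hAx, hj]; rfl⟩
    · rintro _ ⟨_, ⟨x, ⟨hx, hx1⟩, rfl⟩, rfl⟩
      have := (convex_convexHull ℝ (Set.range p)).sum_mem (t := Finset.univ)
        (w := fun o : Option (Fin d) => o.elim (1 - ∑ l, x l) x)
        (z := fun o : Option (Fin d) => o.elim (p j₀) (fun l => p (g l)))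
        (by rintro (_ | l) -; · simpa using hx1
            · exact hx l)
        (by simp [Fintype.sum_option])
        (by rintro (_ | l) - <;> exact subset_convexHull _ _ ⟨_, rfl⟩)
      convert this using 1
      simp only [hAx, Fintype.sum_option, Option.elim, vadd_eq_add, smul_sub,
        Finset.sum_sub_distrib, ← Finset.sum_smul, sub_smul, one_smul]
      abel
  rw [hull, measure_vadd, Measure.addHaar_image_linearMap, ENNReal.toReal_mul,
    ENNReal.toReal_ofReal (abs_nonneg _), LinearMap.det_toLin']

end Simplex

/-- The coefficients of the lift. -/
noncomputable def liftCoeff {d m : ℕ} (g : Fin d → Fin m) (j₀ : Fin m) (k : Fin d)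
    (j : Fin m) : ℝ :=
  open Classical in
  if j = j₀ then -1 else if j = g k then (d + 1) * d.factorial
  else if j ∈ Set.range g then -1 else 1

/-! ### The signed lift and its volume. -/

section Lift

variable {d m : ℕ} {g : Fin d → Fin m} {j₀ : Fin m}

theorem liftCoeff_base (k : Fin d) : liftCoeff g j₀ k j₀ = -1 := by simp [liftCoeff]

theorem liftCoeff_diag (hj : j₀ ∉ Set.range g) (k : Fin d) :
    liftCoeff g j₀ k (g k) = (d + 1) * d.factorial := by
  have : g k ≠ j₀ := fun h => hj ⟨k, h⟩
  simp [liftCoeff, this]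

theorem liftCoeff_offDiag (hg : Function.Injective g) (hj : j₀ ∉ Set.range g) {k l : Fin d}
    (hkl : k ≠ l) : liftCoeff g j₀ k (g l) = -1 := by
  have : g l ≠ j₀ := fun h => hj ⟨l, h⟩
  simp [liftCoeff, this, hg.ne hkl.symm]

theorem liftCoeff_other {j : Fin m} (h0 : j ≠ j₀) (h : j ∉ Set.range g) (k : Fin d) :
    liftCoeff g j₀ k j = 1 := by
  have : j ≠ g k := fun e => h ⟨k, e.symm⟩
  simp [liftCoeff, h0, h, this]

theorem liftCoeff_ne_zero (k : Fin d) (j : Fin m) : liftCoeff g j₀ k j ≠ 0 := by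
  unfold liftCoeff
  split_ifs
  · norm_num
  · positivity
  · norm_num
  · norm_num

/-- With the lift coefficients, a family of points whose absolute values have `g` as an optimal
transversal spans a simplex, of volume bounded below by the product along `g`. -/
theorem volume_convexHull_lift (hd : 1 ≤ d) (hg : Function.Injective g)
    (hj : j₀ ∉ Set.range g) (β : Fin d → Fin m → ℝ) (hβ : ∀ k j, 0 ≤ β k j)
    (hpos : ∀ k, 0 < β k (g k))
    (hopt : ∀ f : Fin d → Fin m, Function.Injective f → ∏ k, β k (f k) ≤ ∏ k, β k (g k)) :
    (volume (convexHull ℝ (Set.range fun j k => liftCoeff g j₀ k j * β k j))).toReal =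
      (Matrix.of fun k l => liftCoeff g j₀ k (g l) * β k (g l) -
        liftCoeff g j₀ k j₀ * β k j₀).det * (volume (cornerSimplex d)).toReal ∧
    ∏ k, β k (g k) ≤ (Matrix.of fun k l => liftCoeff g j₀ k (g l) * β k (g l) -
        liftCoeff g j₀ k j₀ * β k j₀).det := by
  have hd1 : (1 : ℝ) ≤ d := by exact_mod_cast hd
  have hf1 : (1 : ℝ) ≤ d.factorial := by exact_mod_cast Nat.factorial_pos d
  -- With this constant the non-identity Leibniz terms of `S` take at most the fraction `1 / (d +
  -- 1)` of the diagonal product. What remains is `d * d! * C ^ (d - 1) * π`, exactly `d` times the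
  -- later bound for the Cramer numerators.
  set C : ℝ := (d + 1) * d.factorial with hC
  have hC2 : 2 ≤ C := by nlinarith
  set π : ℝ := ∏ k, β k (g k) with hπ
  have hπ0 : 0 < π := Finset.prod_pos fun k _ => hpos k
  set S : Matrix (Fin d) (Fin d) ℝ := Matrix.of fun k l => liftCoeff g j₀ k (g l) * β k (g l)
    with hS
  have hSd : ∀ k, S k k = C * β k (g k) := fun k => by simp [hS, liftCoeff_diag hj, hC]
  have hSo : ∀ k l, k ≠ l → S k l = -β k (g l) := fun k l hkl => by
    simp [hS, liftCoeff_offDiag hg hj hkl]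
  have hSdp : ∀ k, 0 < S k k := fun k => by
    rw [hSd]; exact mul_pos (by linarith) (hpos k)
  have hSprod : ∏ k, S k k = C ^ d * π := by
    simp [hSd, Finset.prod_mul_distrib, hπ]
  have hCd : C * C ^ (d - 1) = C ^ d := by
    rw [← pow_succ']; congr 1; omega
  have habs : ∀ k l, |S k l| ≤ (if k = l then C else 1) * β k (g l) := by
    intro k l
    split_ifs with h
    · subst h; rw [abs_of_pos (hSdp k), hSd]
    · rw [hSo k l h, abs_neg, abs_of_nonneg (hβ _ _), one_mul]
  have hperm : ∀ f : Fin d → Fin m, Function.Injective f → ∀ σ : Equiv.Perm (Fin d),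
      ∏ k, β (σ k) (f k) ≤ π := by
    intro f hf σ
    have := hopt (fun k => f (σ.symm k)) (hf.comp σ.symm.injective)
    rw [← Equiv.prod_comp σ] at this
    simpa using this
  have hcoef : ∀ (c : Fin d → ℝ) (k₀ : Fin d), (∀ k, 0 ≤ c k ∧ c k ≤ C) → c k₀ ≤ 1 →
      ∏ k, c k ≤ C ^ (d - 1) := by
    intro c k₀ hc hk
    rw [← Finset.mul_prod_erase _ _ (Finset.mem_univ k₀)]
    have h1 : ∏ k ∈ Finset.univ.erase k₀, c k ≤ C ^ (d - 1) := by
      refine (Finset.prod_le_prod (fun k _ => (hc k).1) fun k _ => (hc k).2).trans ?_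
      simp
    have h2 : 0 ≤ ∏ k ∈ Finset.univ.erase k₀, c k := Finset.prod_nonneg fun k _ => (hc k).1
    nlinarith
  have hCpos : 0 < C ^ (d - 1) := pow_pos (by linarith) _
  have hdom : ∀ σ : Equiv.Perm (Fin d), σ ≠ 1 → ∏ k, |S (σ k) k| ≤ C⁻¹ * ∏ k, S k k := by
    intro σ hσ
    obtain ⟨k₀, hk₀⟩ : ∃ k, σ k ≠ k := by
      by_contra hcon
      push Not at hcon
      exact hσ (Equiv.ext hcon)
    calc ∏ k, |S (σ k) k| ≤ ∏ k, (if σ k = k then C else 1) * β (σ k) (g k) :=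
          Finset.prod_le_prod (fun _ _ => abs_nonneg _) fun k _ => habs _ _
      _ = (∏ k, (if σ k = k then C else 1)) * ∏ k, β (σ k) (g k) := Finset.prod_mul_distrib
      _ ≤ C ^ (d - 1) * π := by
          refine mul_le_mul (hcoef _ k₀ (fun k => ?_) (by simp [hk₀])) (hperm g hg σ)
            (Finset.prod_nonneg fun k _ => hβ _ _) hCpos.le
          split_ifs <;> constructor <;> linarith
      _ = C⁻¹ * ∏ k, S k k := by
          rw [hSprod, ← hCd]
          field_simp
  have hCi : 0 ≤ C⁻¹ := inv_nonneg.2 (by linarith)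
  have hfC : (Fintype.card (Fin d)).factorial * C⁻¹ = 1 / (d + 1) := by
    rw [Fintype.card_fin, hC]
    field_simp
  have hdet : d / (d + 1) * (C ^ d * π) ≤ S.det := by
    have := le_det_of_diag_dominant S hCi (by rw [hSprod]; positivity) hdom
    rw [hfC, hSprod] at this
    convert this using 2
    field_simp
    ring
  have hdet' : π ≤ S.det := by
    refine le_trans ?_ hdet
    have h1 : (1 : ℝ) ≤ C ^ (d - 1) := one_le_pow₀ (by linarith)
    have h2 : 1 ≤ d / (d + 1) * C ^ d := by
      rw [← hCd, hC]
      have : (d : ℝ) / (d + 1) * ((d + 1) * d.factorial * C ^ (d - 1)) =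
        d * d.factorial * C ^ (d - 1) := by field_simp
      rw [this]
      exact one_le_mul_of_one_le_of_one_le (one_le_mul_of_one_le_of_one_le hd1 hf1) h1
    nlinarith
  have hSdet : S.det ≠ 0 := (hπ0.trans_le hdet').ne'
  have hinv : ∀ j, ∃ x : Fin d → ℝ, (∀ k, 0 ≤ x k) ∧ S.mulVec x = fun k => β k j := by
    intro j
    have hx : S.mulVec (S⁻¹.mulVec fun k => β k j) = fun k => β k j := by
      rw [Matrix.mulVec_mulVec, Matrix.mul_nonsing_inv _ (isUnit_iff_ne_zero.2 hSdet),
        Matrix.one_mulVec]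
    refine ⟨_, fun k => ?_, hx⟩
    refine nonneg_of_mulVec_nonneg S hCi ?_ hSdp ?_ hdom _ ?_ k
    · rw [hfC, div_lt_one (by positivity)]; linarith
    · intro k l hkl; rw [hSo k l hkl]; linarith [hβ k (g l)]
    · intro k; rw [hx]; exact hβ _ _
  have hsum : ∀ j, j ∉ Set.range g → ∀ x : Fin d → ℝ, (S.mulVec x = fun k => β k j) →
      ∑ k, x k ≤ 1 := by
    intro j hjg x hx
    have hk : ∀ k, x k ≤ 1 / d := by
      intro k
      -- Cramer's rule. As `j` is outside the range of `g`, replacing `g k` by `j` is again a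
      -- transversal, so optimality bounds every Leibniz term; the new column lacks the factor `C`.
      have h1 : S.det * x k = (S.updateCol k fun k => β k j).det := by
        rw [← Matrix.cramer_apply, ← hx, Matrix.cramer_eq_adjugate_mulVec, Matrix.mulVec_mulVec,
          Matrix.adjugate_mul, Matrix.smul_mulVec, Matrix.one_mulVec]
        rfl
      have h2 : (S.updateCol k fun k => β k j).det ≤ d.factorial * (C ^ (d - 1) * π) := by
        rw [Matrix.det_apply]
        refine (Finset.sum_le_sum (g := fun _ => C ^ (d - 1) * π) fun σ _ => ?_).trans ?_
        · have h3 : ∏ l, |S.updateCol k (fun k => β k j) (σ l) l| ≤ C ^ (d - 1) * π := by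
            have hfi : Function.Injective (Function.update g k j) := by
              intro a b hab
              by_cases ha : a = k <;> by_cases hb : b = k
              · rw [ha, hb]
              · subst ha
                rw [Function.update_self, Function.update_of_ne hb] at hab
                exact absurd ⟨b, hab.symm⟩ hjg
              · subst hb
                rw [Function.update_self, Function.update_of_ne ha] at hab
                exact absurd ⟨a, hab⟩ hjg
              · rw [Function.update_of_ne ha, Function.update_of_ne hb] at hab
                exact hg hab
            calc _ ≤ ∏ l, (if l = k then 1 else C) * β (σ l) (Function.update g k j l) := by
                  refine Finset.prod_le_prod (fun _ _ => abs_nonneg _) fun l _ => ?_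
                  by_cases hl : l = k
                  · subst hl
                    simp [abs_of_nonneg (hβ _ _)]
                  · rw [Matrix.updateCol_ne hl, Function.update_of_ne hl, if_neg hl]
                    refine (habs _ _).trans (mul_le_mul_of_nonneg_right ?_ (hβ _ _))
                    split_ifs <;> linarith
              _ = (∏ l, if l = k then 1 else C) * ∏ l, β (σ l) (Function.update g k j l) :=
                  Finset.prod_mul_distrib
              _ ≤ _ := by
                  refine mul_le_mul (hcoef _ k (fun k => ?_) (by simp)) (hperm _ hfi σ)
                    (Finset.prod_nonneg fun k _ => hβ _ _) hCpos.le
                  split_ifs <;> constructor <;> linarith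
          rw [← Finset.abs_prod] at h3
          have h4 := abs_le.1 h3
          rcases Int.units_eq_one_or (Equiv.Perm.sign σ) with h5 | h5 <;> rw [h5] <;> simp <;>
            linarith
        · rw [Finset.sum_const, Finset.card_univ, Fintype.card_perm, Fintype.card_fin,
            nsmul_eq_mul]
      have h5 : d * ((d.factorial : ℝ) * (C ^ (d - 1) * π)) ≤ S.det := by
        refine le_trans (le_of_eq ?_) hdet
        rw [← hCd, hC]
        field_simp
      rw [le_div_iff₀ (by linarith)]
      have h6 : S.det * (x k * d) ≤ S.det * 1 := by
        calc S.det * (x k * d) = d * (S.updateCol k fun k => β k j).det := by rw [← h1]; ring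
          _ ≤ d * (d.factorial * (C ^ (d - 1) * π)) :=
            mul_le_mul_of_nonneg_left h2 (by linarith)
          _ ≤ S.det * 1 := by rw [mul_one]; exact h5
      exact le_of_mul_le_mul_left h6 (hπ0.trans_le hdet')
    refine (Finset.sum_le_sum fun k _ => hk k).trans ?_
    have : (d : ℝ) ≠ 0 := by linarith
    simp [this]
  -- The base point is `-S μ` with `μ ≥ 0`, so the origin lies in the simplex. Moving the base point
  -- from the origin to it is a rank-one change of `S`, multiplying the determinant by `1 + ∑ μ`.
  obtain ⟨μ, hμ0, hμ⟩ := hinv j₀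
  set A : Matrix (Fin d) (Fin d) ℝ := Matrix.of fun k l => liftCoeff g j₀ k (g l) * β k (g l) -
        liftCoeff g j₀ k j₀ * β k j₀ with hA
  have hμs : 0 ≤ ∑ l, μ l := Finset.sum_nonneg fun l _ => hμ0 l
  have hAdet : A.det = S.det * (1 + ∑ l, μ l) := by
    have h1 : A = S * (1 + Matrix.replicateCol Unit μ * Matrix.replicateRow Unit fun _ => (1 : ℝ)) := by
      rw [Matrix.mul_add, Matrix.mul_one, ← Matrix.mul_assoc]
      ext k l
      have := congrFun hμ k
      simp only [Matrix.mulVec, dotProduct] at this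
      simp [hA, liftCoeff_base, Matrix.mul_apply, ← this, hS]
    rw [h1, Matrix.det_mul, Matrix.det_one_add_replicateCol_mul_replicateRow]
    simp [dotProduct]
  have hAle : S.det ≤ A.det := by
    rw [hAdet]
    exact le_mul_of_one_le_right (hπ0.le.trans hdet') (by linarith)
  refine ⟨?_, hdet'.trans hAle⟩
  rw [volume_convexHull_eq_of_subset_simplex (fun j k => liftCoeff g j₀ k j * β k j) j₀ g,
    ← hA, abs_of_pos (hπ0.trans_le (hdet'.trans hAle))]
  intro j
  by_cases h0 : j = j₀
  · subst h0
    exact ⟨0, ⟨fun _ => le_rfl, by simp⟩, by simp⟩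
  by_cases hjg : j ∈ Set.range g
  · obtain ⟨l, rfl⟩ := hjg
    refine ⟨Pi.single l 1, ⟨fun k => ?_, by simp⟩, ?_⟩
    · by_cases h : k = l
      · subst h; simp
      · simp [h]
    · simp [Pi.single_apply, ite_smul]
  obtain ⟨x, hx0, hx⟩ := hinv j
  have hx1 := hsum j hjg x hx
  have hone : (0 : ℝ) < 1 + ∑ l, μ l := by linarith
  -- The point is `S x`, which leaves weight `1 - ∑ x` at the origin. Rewriting the origin in terms
  -- of the vertices gives the base point weight `c` and adds `c * μ` to the others.
  set c : ℝ := (1 - ∑ l, x l) / (1 + ∑ l, μ l) with hc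
  have hc0 : 0 ≤ c := div_nonneg (by linarith) hone.le
  have hc1 : c * (1 + ∑ l, μ l) = 1 - ∑ l, x l := div_mul_cancel₀ _ hone.ne'
  have hsumy : ∑ l, (x l + c * μ l) = 1 - c := by
    rw [Finset.sum_add_distrib, ← Finset.mul_sum]
    linarith
  refine ⟨fun l => x l + c * μ l, ⟨fun k => add_nonneg (hx0 k) (mul_nonneg hc0 (hμ0 k)), ?_⟩, ?_⟩
  · rw [hsumy]; linarith
  · funext k
    have e1 := congrFun hx k
    have e2 := congrFun hμ k
    simp only [Matrix.mulVec, dotProduct] at e1 e2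
    have e3 : ∑ l, (x l + c * μ l) * (S k l + β k j₀) = β k j + c * β k j₀ + (1 - c) * β k j₀ := by
      rw [← hsumy, Finset.sum_mul, ← e1]
      conv_rhs => rw [← e2]
      rw [Finset.mul_sum, ← Finset.sum_add_distrib, ← Finset.sum_add_distrib]
      refine Finset.sum_congr rfl fun l _ => ?_
      rw [e2]
      ring
    simp only [Pi.add_apply, Finset.sum_apply, Pi.smul_apply, Pi.sub_apply, smul_eq_mul,
      liftCoeff_base, liftCoeff_other h0 hjg]
    have e4 : ∀ l, liftCoeff g j₀ k (g l) * β k (g l) = S k l := fun l => rfl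
    simp only [e4, neg_one_mul, sub_neg_eq_add, e3]
    ring

end Lift

/-! ### Polynomials as Puiseux series. -/

section Puiseux

open Polynomial

/-- A real polynomial in the parameter as a Puiseux series. -/
noncomputable def ofPolynomial (p : ℝ[X]) : PuiseuxSeries where
  -- The test says that `α` is a natural number.
  coeff α := open Classical in if (⌊α⌋₊ : ℝ) = α then p.coeff ⌊α⌋₊ else 0
  finite_above r := by
    refine (p.support.image fun n : ℕ => (n : ℝ)).finite_toSet.subset ?_
    rintro α ⟨h, -⟩
    split_ifs at h with hα
    · simp only [Finset.coe_image, Set.mem_image, Finset.mem_coe, mem_support_iff]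
      exact ⟨_, h, hα⟩
    · exact absurd rfl h
  convergent := by
    refine ⟨1, one_pos, summable_of_hasFiniteSupport ?_⟩
    refine (p.support.image fun n : ℕ => (n : ℝ)).finite_toSet.subset ?_
    intro α h
    simp only [Function.mem_support, Real.one_rpow, mul_one, ne_eq, abs_eq_zero] at h
    split_ifs at h with hα
    · simp only [Finset.coe_image, Set.mem_image, Finset.mem_coe, mem_support_iff]
      exact ⟨_, h, hα⟩
    · exact absurd rfl h

theorem ofPolynomial_coeff_natCast (p : ℝ[X]) (n : ℕ) :
    (ofPolynomial p).coeff n = p.coeff n := by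
  simp [ofPolynomial]

theorem exists_of_ofPolynomial_coeff_ne_zero {p : ℝ[X]} {α : ℝ}
    (h : (ofPolynomial p).coeff α ≠ 0) : ∃ n : ℕ, (n : ℝ) = α ∧ p.coeff n ≠ 0 := by
  simp only [ofPolynomial] at h
  split_ifs at h with hα
  · exact ⟨_, hα, h⟩
  · exact absurd rfl h

theorem ofPolynomial_eval (p : ℝ[X]) (t : ℝ) : (ofPolynomial p).eval t = p.eval t := by
  rw [PuiseuxSeries.eval, tsum_eq_sum (s := p.support.image fun n : ℕ => (n : ℝ)),
    Finset.sum_image fun a _ b _ h => Nat.cast_injective h, eval_eq_sum, sum_def]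
  · refine Finset.sum_congr rfl fun n _ => ?_
    rw [ofPolynomial_coeff_natCast, Real.rpow_natCast]
  · intro α hα
    by_cases h : (ofPolynomial p).coeff α = 0
    · rw [h, zero_mul]
    · obtain ⟨n, hn, hp⟩ := exists_of_ofPolynomial_coeff_ne_zero h
      refine absurd ?_ hα
      rw [Finset.mem_image]
      exact ⟨n, mem_support_iff.2 hp, hn⟩

theorem le_ofPolynomial_val {p : ℝ[X]} {n : ℕ} (hn : p.coeff n ≠ 0) :
    ((n : ℝ) : EReal) ≤ (ofPolynomial p).val :=
  le_iSup₂ (f := fun (α : ℝ) (_ : α ∈ {α : ℝ | (ofPolynomial p).coeff α ≠ 0}) => (α : EReal))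
    (n : ℝ) (by rw [Set.mem_ofPred_eq, ofPolynomial_coeff_natCast]; exact hn)

theorem ofPolynomial_val_zero : (ofPolynomial 0).val = ⊥ := by
  refine le_bot_iff.1 (iSup₂_le fun α hα => ?_)
  obtain ⟨n, -, hn⟩ := exists_of_ofPolynomial_coeff_ne_zero hα
  exact absurd (coeff_zero n) hn

theorem ofPolynomial_val_monomial {c : ℝ} (hc : c ≠ 0) (n : ℕ) :
    (ofPolynomial (C c * X ^ n)).val = ((n : ℝ) : EReal) := by
  apply le_antisymm
  · refine iSup₂_le fun α hα => ?_
    obtain ⟨k, rfl, hk⟩ := exists_of_ofPolynomial_coeff_ne_zero hα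
    rw [coeff_C_mul_X_pow] at hk
    have : k = n := by
      by_contra h
      simp [h] at hk
    rw [this]
  · exact le_ofPolynomial_val (by simpa using hc)

/-- Otherwise `p / X ^ n` would tend to `0` while staying at least `1`. -/
theorem le_natDegree_of_pow_le {p : ℝ[X]} {n : ℕ} (h : ∀ t : ℝ, 1 ≤ t → t ^ n ≤ p.eval t) :
    n ≤ p.natDegree := by
  by_contra hlt
  push Not at hlt
  have hdeg : p.degree < (X ^ n : ℝ[X]).degree := by
    rw [degree_X_pow]
    exact degree_le_natDegree.trans_lt (by exact_mod_cast hlt)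
  have ht := div_tendsto_atTop_zero_of_degree_lt p (X ^ n) hdeg
  have : (1 : ℝ) ≤ 0 := by
    refine ge_of_tendsto ht ?_
    filter_upwards [eventually_ge_atTop 1] with t h1
    rw [eval_pow, eval_X, one_le_div (by positivity)]
    exact h t h1
  linarith

end Puiseux

/-! ### From optimal transversals to the dequantized volume. -/

section Dequantization

open Polynomial

variable {d m : ℕ}

/-- A tropically optimal transversal of `M` is a lower bound for the dequantized volume, provided
`M` has a further column. -/
theorem optimal_transversal_le_qtvol (hd : 1 ≤ d) (M : Matrix (Fin d) (Fin m) T)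
    (hM : ∀ k j, M k j = ⊥ ∨ ∃ n : ℕ, M k j = ((n : ℝ) : T)) {g : Fin d → Fin m} {j₀ : Fin m}
    (hg : Function.Injective g) (hj : j₀ ∉ Set.range g) (hne : ∀ k, M k (g k) ≠ ⊥)
    (hopt : ∀ f : Fin d → Fin m, Function.Injective f →
      ∑ k, M k (f k) ≤ ∑ k, M k (g k)) :
    toE (∑ k, M k (g k)) ≤ qtvol M := by
  have hex : ∀ k j, ∃ (b : ℝ[X]) (n : ℕ),
      (M k j = ⊥ ∧ b = 0) ∨ (M k j = ((n : ℝ) : T) ∧ b = X ^ n) := by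
    intro k j
    rcases hM k j with h | ⟨n, h⟩
    · exact ⟨0, 0, Or.inl ⟨h, rfl⟩⟩
    · exact ⟨X ^ n, n, Or.inr ⟨h, rfl⟩⟩
  choose b N hbN using hex
  have hfin : ∀ k j, M k j ≠ ⊥ → M k j = ((N k j : ℝ) : T) ∧ b k j = X ^ N k j := fun k j h =>
    (hbN k j).resolve_left fun h' => h h'.1
  have hsum : ∀ f : Fin d → Fin m, (∀ k, M k (f k) ≠ ⊥) →
      ∑ k, M k (f k) = (((∑ k, N k (f k) : ℕ) : ℝ) : T) := by
    intro f hf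
    rw [Finset.sum_congr rfl fun k _ => (hfin k (f k) (hf k)).1]
    push_cast
    rfl
  have hβ : ∀ t : ℝ, 1 ≤ t → ∀ k j, 0 ≤ (b k j).eval t := by
    intro t ht k j
    rcases hbN k j with ⟨-, h⟩ | ⟨-, h⟩
    · simp [h]
    · rw [h, eval_pow, eval_X]; positivity
  have hprod : ∀ f : Fin d → Fin m, (∀ k, M k (f k) ≠ ⊥) → ∀ t : ℝ,
      ∏ k, (b k (f k)).eval t = t ^ ∑ k, N k (f k) := by
    intro f hf t
    rw [← Finset.prod_pow_eq_pow_sum]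
    refine Finset.prod_congr rfl fun k _ => ?_
    rw [(hfin k (f k) (hf k)).2, eval_pow, eval_X]
  have hoptβ : ∀ t : ℝ, 1 ≤ t → ∀ f : Fin d → Fin m, Function.Injective f →
      ∏ k, (b k (f k)).eval t ≤ ∏ k, (b k (g k)).eval t := by
    intro t ht f hf
    by_cases hfb : ∀ k, M k (f k) ≠ ⊥
    · rw [hprod f hfb, hprod g hne]
      refine pow_le_pow_right₀ ht ?_
      have := hopt f hf
      rw [hsum f hfb, hsum g hne, WithBot.coe_le_coe] at this
      exact_mod_cast this
    · push Not at hfb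
      obtain ⟨k, hk⟩ := hfb
      have : b k (f k) = 0 := by
        rcases hbN k (f k) with ⟨-, h⟩ | ⟨h, -⟩
        · exact h
        · rw [hk] at h; exact absurd h.symm WithBot.coe_ne_bot
      rw [Finset.prod_eq_zero (Finset.mem_univ k) (by rw [this, eval_zero])]
      exact Finset.prod_nonneg fun k _ => hβ t ht k _
  have hpos : ∀ t : ℝ, 1 ≤ t → ∀ k, 0 < (b k (g k)).eval t := by
    intro t ht k
    rw [(hfin k (g k) (hne k)).2, eval_pow, eval_X]
    positivity
  set D : ℝ[X] := (Matrix.of fun k l => C (liftCoeff g j₀ k (g l)) * b k (g l) -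
    C (liftCoeff g j₀ k j₀) * b k j₀).det with hD
  set c : ℝ := (volume (cornerSimplex d)).toReal with hc
  have hc0 : 0 < c := volume_cornerSimplex_toReal_pos hd
  have hDeval : ∀ t : ℝ, D.eval t =
      (Matrix.of fun k l => liftCoeff g j₀ k (g l) * (b k (g l)).eval t -
        liftCoeff g j₀ k j₀ * (b k j₀).eval t).det := by
    intro t
    rw [hD, ← coe_evalRingHom, RingHom.map_det]
    congr 1
    ext k l
    simp
  have hvol := fun (t : ℝ) (ht : 1 ≤ t) => volume_convexHull_lift hd hg hj
    (fun k j => (b k j).eval t) (hβ t ht) (hpos t ht) (hoptβ t ht)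
  have hdeg : ∑ k, N k (g k) ≤ D.natDegree := by
    refine le_natDegree_of_pow_le fun t ht => ?_
    rw [← hprod g hne, hDeval]
    exact (hvol t ht).2
  have hD0 : D ≠ 0 := by
    intro h
    have h1 := (hvol 1 le_rfl).2
    rw [← hDeval, h, eval_zero, hprod g hne, one_pow] at h1
    linarith
  have hval : toE (∑ k, M k (g k)) ≤ (ofPolynomial (C c * D)).val := by
    refine le_trans ?_ (le_ofPolynomial_val (n := D.natDegree) ?_)
    · rw [hsum g hne]
      exact EReal.coe_le_coe_iff.2 (by exact_mod_cast hdeg)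
    · rw [coeff_C_mul]
      exact mul_ne_zero hc0.ne' (leadingCoeff_ne_zero.2 hD0)
  refine hval.trans (le_sSup ⟨Matrix.of fun k j => ofPolynomial (C (liftCoeff g j₀ k j) * b k j),
    _, fun k j => ?_, ?_, rfl⟩)
  · rw [Matrix.of_apply]
    rcases hbN k j with ⟨h1, h2⟩ | ⟨h1, h2⟩
    · rw [h1, h2, mul_zero, ofPolynomial_val_zero]
      rfl
    · rw [h1, h2, ofPolynomial_val_monomial (liftCoeff_ne_zero k j)]
      rfl
  · filter_upwards [eventually_ge_atTop 1] with t ht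
    rw [ofPolynomial_eval, eval_mul, eval_C, hDeval, mul_comm, ← (hvol t ht).1]
    simp only [Matrix.of_apply, ofPolynomial_eval, eval_mul, eval_C]

theorem tbvol_le_qtvol (hd : 1 ≤ d) (M : Matrix (Fin d) (Fin m) T)
    (hM : ∀ k j, M k j = ⊥ ∨ ∃ n : ℕ, M k j = ((n : ℝ) : T)) :
    tbvol (tconv (cols M)) ≤ qtvol M := by
  classical
  refine iSup₂_le ?_
  rintro x ⟨F, ⟨-, G, hG, hi, hFG⟩, hx⟩
  obtain ⟨K, J, j₁, hK, hJ, hj₁, hne, hle⟩ := exists_transversal hG hi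
  set κ : Equiv.Perm (Fin d) := Equiv.ofBijective K (Finite.injective_iff_bijective.1 hK) with hκ
  set f₀ : Fin d → Fin m := fun k => J (κ.symm k) with hf₀
  have hf₀i : Function.Injective f₀ := hJ.comp κ.symm.injective
  have hKκ : ∀ k, K (κ.symm k) = k := κ.apply_symm_apply
  have hf₀x : ∑ k, x k ≤ ∑ k, M k (f₀ k) := Finset.sum_le_sum fun k _ => by
    have := hle x (hFG hx) (κ.symm k)
    rwa [hKκ] at this
  have hf₀ne : ∀ k, M k (f₀ k) ≠ ⊥ := fun k => by
    have := hne (κ.symm k)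
    rwa [hKκ] at this
  obtain ⟨g, hg, hmax⟩ := (Finset.univ.filter fun f : Fin d → Fin m =>
    Function.Injective f).exists_max_image (fun f => ∑ k, M k (f k)) ⟨f₀, by simpa using hf₀i⟩
  simp only [Finset.mem_filter, Finset.mem_univ, true_and] at hg hmax
  have hbot : ∀ f : Fin d → Fin m, (∑ k, M k (f k)) ≠ ⊥ ↔ ∀ k, M k (f k) ≠ ⊥ := by
    intro f
    simp [WithBot.sum_eq_bot_iff]
  have hgne : ∀ k, M k (g k) ≠ ⊥ := by
    rw [← hbot]
    exact ne_bot_of_le_ne_bot ((hbot f₀).2 hf₀ne) (hmax f₀ hf₀i)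
  -- The optimal `g` may use the spare column `j₁`, but `J` and `j₁` together show that there are
  -- more than `d` columns.
  obtain ⟨j₀, hj₀⟩ : ∃ j₀, j₀ ∉ Set.range g := by
    by_contra hcon
    push Not at hcon
    have h1 : m ≤ d := by simpa using Fintype.card_le_of_surjective g hcon
    have h2 : d ≤ m := by simpa using Fintype.card_le_of_injective g hg
    exact hj₁ (((Fintype.bijective_iff_injective_and_card J).2
      ⟨hJ, by simpa using h2.antisymm h1⟩).2 j₁)
  exact (toE_mono (hf₀x.trans (hmax f₀ hf₀i))).trans
    (optimal_transversal_le_qtvol hd M hM hg hj₀ hgne hmax)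

end Dequantization

end TropVol

theorem mainTheorem7 {d m : ℕ} (hd : 1 ≤ d) (M : Matrix (Fin d) (Fin m) TropVol.T)
    (hM : ∀ k j, M k j = ⊥ ∨ ∃ n : ℕ, M k j = ((n : ℝ) : TropVol.T)) :
    (∀ i : ℕ, 1 ≤ i → i ≤ d →
      TropVol.tbvolLower i (TropVol.tconv (TropVol.cols M)) ≤ TropVol.toE (TropVol.tminor i M)) ∧
    TropVol.tbvol (TropVol.tconv (TropVol.cols M)) ≤ TropVol.qtvol M :=
  ⟨fun i _ _ => TropVol.tbvolLower_le_tminor M i, TropVol.tbvol_le_qtvol hd M hM⟩
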